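/- **Theorem (Soundness of VCGSem).** Consider the following core of the Viper language. *Syntax.* Expressions: literals, variables, unary and binary operators (with lazy Boolean operators, and failing division by zero), conditional expressions, field accesses $e.f$. Assertions: $A ::= e \mid \mathrm{acc}(e.f,p) \mid \mathrm{acc}(e.f,\_) \mid A * A \mid e \Rightarrow A \mid e\,?\,A : A$. Statements: $s ::= \mathbf{skip} \mid \mathbf{inhale}\,A \mid \mathbf{exhale}\,A \mid s;s \mid \mathbf{if}(e)\{s\}\,\mathbf{else}\,\{s\} \mid x := e \mid \mathbf{havoc}\,x \mid e.f := e$. Values are integers, Booleans, real permission amounts and references (null or an address); heap locations are pairs of an address and a field. A context $\Gamma$ declares the types of variables and fields. *ViperCore.* A state $\omega=(\sigma,h,\pi)$ consists of a store, a partial heap $h$ and a permission mask $\pi$ into $[0,1]$, with $h(l)$ defined whenever $\pi(l)>0$; it is *stable* if $h(l)$ is defined exactly where $\pi(l)>0$, and $\mathrm{stabilize}(\omega)$ erases all values at locations without permission. $\omega_1\oplus\omega_2$ is defined iff the stores are equal, the heaps agree on common locations and permissions sum to at most $1$; it unites the heaps and adds the masks. A set of states $P$ is self-framing if $\omega\in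 P\Leftrightarrow \mathrm{stabilize}(\omega)\in P$ for all well-typed $\omega$. Semantic statements, with sets of states as assertions and partial functions on states as expressions, are executed by a judgment $\langle C,\omega\rangle\to_\Gamma S$, where $S$ is the set of final states for all demonic choices: $\mathbf{inhale}\,A$ requires $\{\omega\}*A$ to be self-framing and yields all stable well-typed $\omega\oplus\omega_A$ with $\omega_A\in A$; $\mathbf{exhale}\,A$ yields $\{\omega'\}$ for any angelically chosen stable $\omega'$ with $\omega=\omega'\oplus\omega_A$, $\omega_A\in A$; $\mathbf{havoc}$ yields all values of the type of the variable; a sequential composition runs its second part from every intermediate state, with angelic choices per state; a field assignment requires permission $1$; the remaining rules are the usual ones. $C$ is *correct* for $\omega$ if $\langle C,\omega\rangle\to_\Gamma S$ for some $S$. The translation $[\![s]\!]$ replaces expressions and assertions by their partial-heap semantics; a state satisfying an assertion holds exactly the permissions it specifies ($\mathrm{acc}(e.f,\_)$: some non-zero amount), and pure assertions hold in states without permissions. *VCGSem.* A state $\sigma_t$ consists of a store, a total heap and a permission mask. The big-step judgment $\Gamma\vdash\langle s,\sigma_t\rangle\to r$ has outcomes $r$: failure $\mathsf F$, magic $\mathsf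 M$, or a normal outcome $\mathsf N(\sigma_t')$. Heap accesses without permission, division by zero, negative permission amounts, field assignments without permission $1$, and exhaled assertions that do not hold lead to failure; inconsistent inhaled assumptions lead to magic. An inhale leaves the heap unchanged; exhaling $\mathrm{acc}(e.f,\_)$ demonically removes a non-zero amount smaller than the amount held; after an exhale all locations to which all permission was lost get arbitrary new values of the right type. *Claim.* Write $\omega\sim_\Gamma\sigma_t$ if $\sigma_t$ is well-typed, has the same store and mask as $\omega$, and its total heap extends the partial heap of $\omega$. Let $s$ be a well-typed statement and $\omega$ a stable, well-typed ViperCore state. If $$\neg\bigl(\Gamma\vdash\langle s,\sigma_t\rangle\to\mathsf F\bigr)\quad\text{for all VCGSem states }\sigma_t\text{ with }\omega\sim_\Gamma\sigma_t,$$ then $[\![s]\!]$ is correct for $\omega$ in ViperCore. (Since the total heap is unconstrained at locations without permission, one ViperCore execution is related to a set of VCGSem executions.) -/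

import Mathlib

/-! # A core Viper language, its partial-heap semantics (ViperCore) and the total-heap big-step
semantics of the verification condition generator (VCGSem) -/

namespace ViperVCG

/-! ## Values, types, syntax -/

abbrev Addr := ℕ
abbrev VarName := String
abbrev FieldName := String

/-- Heap locations: an address (a non-null reference) and a field. -/
abbrev Loc := Addr × FieldName

inductive Ref
  | null
  | addr (a : Addr)

inductive Val
  | int (i : ℤ)
  | bool (b : Bool)
  | perm (p : ℝ)
  | ref (r : Ref)

inductive VTyp
  | int
  | bool
  | perm
  | ref

/-- Types are sets of values: `v` belongs to the type `τ` iff `v.ty = τ`. -/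
def Val.ty : Val → VTyp
  | .int _ => .int
  | .bool _ => .bool
  | .perm _ => .perm
  | .ref _ => .ref

inductive Unop
  | not
  | neg

inductive Binop
  | add | sub | mul | intDiv | mod | permDiv
  | eq | neq | lt | le | gt | ge
  | and | or | imp

/-- Pure expressions. -/
inductive Expr
  | lit (v : Val)
  | var (x : VarName)
  | unop (o : Unop) (e : Expr)
  | binop (e₁ : Expr) (o : Binop) (e₂ : Expr)
  | cond (b e₁ e₂ : Expr)
  | field (e : Expr) (f : FieldName)

/-- Assertions: `e`, `acc(e.f, p)`, `acc(e.f, _)`, `A * B`, `e ⇒ A`, `e ? A : B`. -/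
inductive Assertion
  | pure (e : Expr)
  | acc (e : Expr) (f : FieldName) (p : Expr)
  | accWild (e : Expr) (f : FieldName)
  | star (A B : Assertion)
  | imp (e : Expr) (A : Assertion)
  | cond (e : Expr) (A B : Assertion)

/-- (Syntactic) statements. -/
inductive Stmt
  | skip
  | inhale (A : Assertion)
  | exhale (A : Assertion)
  | seq (s₁ s₂ : Stmt)
  | ite (b : Expr) (s₁ s₂ : Stmt)
  | assign (x : VarName) (e : Expr)
  | havoc (x : VarName)
  | fieldAssign (e₁ : Expr) (f : FieldName) (e₂ : Expr)

/-- Typing contexts: the declared local variables and the declared fields. -/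
structure Ctx where
  vars : VarName → Option VTyp
  fields : FieldName → Option VTyp

/-! ## Typing of expressions, assertions and statements -/

inductive Unop.Sig : Unop → VTyp → VTyp → Prop
  | not : Unop.Sig .not .bool .bool
  | negInt : Unop.Sig .neg .int .int
  | negPerm : Unop.Sig .neg .perm .perm

inductive Binop.Sig : Binop → VTyp → VTyp → VTyp → Prop
  | addInt : Binop.Sig .add .int .int .int
  | addPerm : Binop.Sig .add .perm .perm .perm
  | subInt : Binop.Sig .sub .int .int .int
  | subPerm : Binop.Sig .sub .perm .perm .perm
  | mulInt : Binop.Sig .mul .int .int .int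
  | mulPerm : Binop.Sig .mul .perm .perm .perm
  | mulIntPerm : Binop.Sig .mul .int .perm .perm
  | intDiv : Binop.Sig .intDiv .int .int .int
  | mod : Binop.Sig .mod .int .int .int
  | permDivInt : Binop.Sig .permDiv .int .int .perm
  | permDivPermInt : Binop.Sig .permDiv .perm .int .perm
  | permDivPerm : Binop.Sig .permDiv .perm .perm .perm
  | eq (τ : VTyp) : Binop.Sig .eq τ τ .bool
  | neq (τ : VTyp) : Binop.Sig .neq τ τ .bool
  | ltInt : Binop.Sig .lt .int .int .bool
  | ltPerm : Binop.Sig .lt .perm .perm .bool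
  | leInt : Binop.Sig .le .int .int .bool
  | lePerm : Binop.Sig .le .perm .perm .bool
  | gtInt : Binop.Sig .gt .int .int .bool
  | gtPerm : Binop.Sig .gt .perm .perm .bool
  | geInt : Binop.Sig .ge .int .int .bool
  | gePerm : Binop.Sig .ge .perm .perm .bool
  | and : Binop.Sig .and .bool .bool .bool
  | or : Binop.Sig .or .bool .bool .bool
  | imp : Binop.Sig .imp .bool .bool .bool

inductive Expr.Typed (Γ : Ctx) : Expr → VTyp → Prop
  | lit (v : Val) : Expr.Typed Γ (.lit v) v.ty
  | var {x : VarName} {τ : VTyp} : Γ.vars x = some τ → Expr.Typed Γ (.var x) τ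
  | unop {o : Unop} {e : Expr} {τ τ' : VTyp} :
      Expr.Typed Γ e τ → Unop.Sig o τ τ' → Expr.Typed Γ (.unop o e) τ'
  | binop {e₁ e₂ : Expr} {o : Binop} {τ₁ τ₂ τ : VTyp} :
      Expr.Typed Γ e₁ τ₁ → Expr.Typed Γ e₂ τ₂ → Binop.Sig o τ₁ τ₂ τ →
      Expr.Typed Γ (.binop e₁ o e₂) τ
  | cond {b e₁ e₂ : Expr} {τ : VTyp} :
      Expr.Typed Γ b .bool → Expr.Typed Γ e₁ τ → Expr.Typed Γ e₂ τ →
      Expr.Typed Γ (.cond b e₁ e₂) τ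
  | field {e : Expr} {f : FieldName} {τ : VTyp} :
      Expr.Typed Γ e .ref → Γ.fields f = some τ → Expr.Typed Γ (.field e f) τ

def Assertion.Typed (Γ : Ctx) : Assertion → Prop
  | .pure e => e.Typed Γ .bool
  | .acc e f p => e.Typed Γ .ref ∧ (∃ τ, Γ.fields f = some τ) ∧ p.Typed Γ .perm
  | .accWild e f => e.Typed Γ .ref ∧ ∃ τ, Γ.fields f = some τ
  | .star A B => A.Typed Γ ∧ B.Typed Γ
  | .imp e A => e.Typed Γ .bool ∧ A.Typed Γ
  | .cond e A B => e.Typed Γ .bool ∧ A.Typed Γ ∧ B.Typed Γ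

def Stmt.Typed (Γ : Ctx) : Stmt → Prop
  | .skip => True
  | .inhale A => A.Typed Γ
  | .exhale A => A.Typed Γ
  | .seq s₁ s₂ => s₁.Typed Γ ∧ s₂.Typed Γ
  | .ite b s₁ s₂ => b.Typed Γ .bool ∧ s₁.Typed Γ ∧ s₂.Typed Γ
  | .assign x e => ∃ τ, Γ.vars x = some τ ∧ e.Typed Γ τ
  | .havoc x => ∃ τ, Γ.vars x = some τ
  | .fieldAssign e₁ f e₂ => e₁.Typed Γ .ref ∧ ∃ τ, Γ.fields f = some τ ∧ e₂.Typed Γ τ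

/-! ## Operators (shared by both semantics) -/

/-- Result of an evaluation: a value, a failure (an ill-defined expression, such as a division by
zero or a heap access without permission), or stuck (a type error: no rule applies). -/
inductive Res
  | val (v : Val)
  | fail
  | stuck

def Unop.eval : Unop → Val → Res
  | .not, .bool b => .val (.bool (!b))
  | .neg, .int i => .val (.int (-i))
  | .neg, .perm p => .val (.perm (-p))
  | _, _ => .stuck

/-- The value of a lazy operator that is determined by its left operand alone. -/
def Binop.evalLazy : Binop → Val → Option Val
  | .and, .bool false => some (.bool false)
  | .or, .bool true => some (.bool true)
  | .imp, .bool false => some (.bool true)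
  | _, _ => none

open Classical in
/-- `intDiv` and `mod` are Euclidean (as in SMT-LIB and Boogie). -/
noncomputable def Binop.eval : Binop → Val → Val → Res
  | .add, .int a, .int b => .val (.int (a + b))
  | .add, .perm a, .perm b => .val (.perm (a + b))
  | .sub, .int a, .int b => .val (.int (a - b))
  | .sub, .perm a, .perm b => .val (.perm (a - b))
  | .mul, .int a, .int b => .val (.int (a * b))
  | .mul, .perm a, .perm b => .val (.perm (a * b))
  | .mul, .int a, .perm b => .val (.perm (a * b))
  | .intDiv, .int a, .int b => if b = 0 then .fail else .val (.int (a / b))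
  | .mod, .int a, .int b => if b = 0 then .fail else .val (.int (a % b))
  | .permDiv, .int a, .int b => if b = 0 then .fail else .val (.perm ((a : ℝ) / (b : ℝ)))
  | .permDiv, .perm a, .int b => if b = 0 then .fail else .val (.perm (a / (b : ℝ)))
  | .permDiv, .perm a, .perm b => if b = 0 then .fail else .val (.perm (a / b))
  | .eq, v, w => .val (.bool (decide (v = w)))
  | .neq, v, w => .val (.bool (decide (v ≠ w)))
  | .lt, .int a, .int b => .val (.bool (decide (a < b)))
  | .lt, .perm a, .perm b => .val (.bool (decide (a < b)))
  | .le, .int a, .int b => .val (.bool (decide (a ≤ b)))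
  | .le, .perm a, .perm b => .val (.bool (decide (a ≤ b)))
  | .gt, .int a, .int b => .val (.bool (decide (b < a)))
  | .gt, .perm a, .perm b => .val (.bool (decide (b < a)))
  | .ge, .int a, .int b => .val (.bool (decide (b ≤ a)))
  | .ge, .perm a, .perm b => .val (.bool (decide (b ≤ a)))
  | .and, .bool a, .bool b => .val (.bool (a && b))
  | .or, .bool a, .bool b => .val (.bool (a || b))
  | .imp, .bool a, .bool b => .val (.bool (!a || b))
  | _, _, _ => .stuck

def Res.toOption : Res → Option Val
  | .val v => some v
  | _ => none

/-- The store assigns to every declared variable a value of its type. -/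
def StoreTyped (Γ : Ctx) (s : VarName → Option Val) : Prop :=
  ∀ x τ, Γ.vars x = some τ → ∃ v, s x = some v ∧ v.ty = τ

/-! ## ViperCore: CoreIVL over partial heaps with fractional permissions -/

/-- ViperCore states: a store of local variables, a partial heap and a permission mask with values
in `[0, 1]`, where every location with non-zero permission has a value. -/
structure VState where
  store : VarName → Option Val
  heap : Loc → Option Val
  mask : Loc → ℝ
  mask_nonneg : ∀ l, 0 ≤ mask l
  mask_le_one : ∀ l, mask l ≤ 1
  heap_isSome : ∀ l, 0 < mask l → (heap l).isSome

namespace VState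

/-- `a ⊕ b` is defined: the stores are identical, the permissions sum to at most `1`, and the
heaps agree on their common domain. -/
def Compat (a b : VState) : Prop :=
  a.store = b.store ∧ (∀ l, a.mask l + b.mask l ≤ 1) ∧
    ∀ l v w, a.heap l = some v → b.heap l = some w → v = w

open Classical in
/-- The partial addition `a ⊕ b`. -/
noncomputable def add (a b : VState) : Option VState :=
  if h : Compat a b then
    some
      { store := a.store
        heap := fun l => (a.heap l).or (b.heap l)
        mask := fun l => a.mask l + b.mask l
        mask_nonneg := fun l => add_nonneg (a.mask_nonneg l) (b.mask_nonneg l)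
        mask_le_one := h.2.1
        heap_isSome := by
          intro l hl
          have ha := a.heap_isSome l
          have hb := b.heap_isSome l
          rw [Option.isSome_or, Bool.or_eq_true]
          by_cases h0 : 0 < a.mask l
          · exact Or.inl (ha h0)
          · exact Or.inr (hb (by linarith)) }
  else none

/-- A state is stable iff it has values exactly at the locations with non-zero permission. -/
def Stable (ω : VState) : Prop := ∀ l, (ω.heap l).isSome ↔ 0 < ω.mask l

open Classical in
/-- Erase the values of all locations without permission. -/
noncomputable def stabilize (ω : VState) : VState where
  store := ω.store
  heap := fun l => if 0 < ω.mask l then ω.heap l else none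
  mask := ω.mask
  mask_nonneg := ω.mask_nonneg
  mask_le_one := ω.mask_le_one
  heap_isSome := by
    intro l hl
    rw [if_pos hl]
    exact ω.heap_isSome l hl

/-- The state is well-typed: store and heap contain values of the declared types. -/
def Typed (Γ : Ctx) (ω : VState) : Prop :=
  StoreTyped Γ ω.store ∧
    ∀ (a : Addr) (f : FieldName) (v : Val) (τ : VTyp),
      ω.heap (a, f) = some v → Γ.fields f = some τ → v.ty = τ

/-- `ω[x ↦ v]` -/
def setVar (ω : VState) (x : VarName) (v : Val) : VState :=
  { ω with store := Function.update ω.store x (some v) }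

/-- `(σ, (h[l ↦ v], π))` -/
def setLoc (ω : VState) (l : Loc) (v : Val) : VState :=
  { ω with
    heap := Function.update ω.heap l (some v)
    heap_isSome := by
      intro l' hl'
      by_cases h : l' = l
      · subst h; simp
      · rw [Function.update_of_ne h]
        exact ω.heap_isSome l' hl' }

end VState

/-- The separating conjunction `P * Q` of sets of states. -/
def sepConj (P Q : Set VState) : Set VState :=
  {ω | ∃ a ∈ P, ∃ b ∈ Q, VState.add a b = some ω}

/-- `P` is self-framing. As everywhere in ViperCore, only well-typed states are considered. -/
def SelfFraming (Γ : Ctx) (P : Set VState) : Prop :=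
  ∀ ω : VState, ω.Typed Γ → (ω ∈ P ↔ ω.stabilize ∈ P)

/-- The state `ω` frames the assertion `A`. -/
def Frames (Γ : Ctx) (ω : VState) (A : Set VState) : Prop :=
  SelfFraming Γ (sepConj {ω} A)

/-- Semantic expressions: partial functions from states to values. -/
abbrev SemExpr := VState → Option Val

/-- ViperCore statements: assertions are sets of states, expressions are partial functions; field
assignment is the custom statement. -/
inductive CStmt
  | skip
  | inhale (A : Set VState)
  | exhale (A : Set VState)
  | seq (C₁ C₂ : CStmt)
  | ite (b : SemExpr) (C₁ C₂ : CStmt)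
  | assign (x : VarName) (e : SemExpr)
  | havoc (x : VarName)
  | fieldAssign (e₁ : SemExpr) (f : FieldName) (e₂ : SemExpr)

/-- The operational semantics `⟨C, ω⟩ →_Γ S`: the set `S` collects the demonic choices, different
derivable sets `S` reflect the angelic choices. -/
inductive CRed (Γ : Ctx) : CStmt → VState → Set VState → Prop
  | skip (ω : VState) : CRed Γ .skip ω {ω}
  | inhale (A : Set VState) (ω : VState) :
      Frames Γ ω A →
      CRed Γ (.inhale A) ω
        {ω' | (∃ ωA ∈ A, VState.add ω ωA = some ω') ∧ ω'.Stable ∧ ω'.Typed Γ}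
  | exhale (A : Set VState) (ω ω' ωA : VState) :
      VState.add ω' ωA = some ω → ωA ∈ A → ω'.Stable →
      CRed Γ (.exhale A) ω {ω'}
  | seq (C₁ C₂ : CStmt) (ω : VState) (S₁ : Set VState) (S : VState → Set VState) :
      CRed Γ C₁ ω S₁ → (∀ ω₁ ∈ S₁, CRed Γ C₂ ω₁ (S ω₁)) →
      CRed Γ (.seq C₁ C₂) ω (⋃ ω₁ ∈ S₁, S ω₁)
  | iteTrue (b : SemExpr) (C₁ C₂ : CStmt) (ω : VState) (S : Set VState) :
      b ω = some (.bool true) → CRed Γ C₁ ω S → CRed Γ (.ite b C₁ C₂) ω S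
  | iteFalse (b : SemExpr) (C₁ C₂ : CStmt) (ω : VState) (S : Set VState) :
      b ω = some (.bool false) → CRed Γ C₂ ω S → CRed Γ (.ite b C₁ C₂) ω S
  | assign (x : VarName) (e : SemExpr) (ω : VState) (τ : VTyp) (v : Val) :
      Γ.vars x = some τ → e ω = some v → v.ty = τ →
      CRed Γ (.assign x e) ω {ω.setVar x v}
  | havoc (x : VarName) (ω : VState) (τ : VTyp) :
      Γ.vars x = some τ →
      CRed Γ (.havoc x) ω {ω' | ∃ v : Val, v.ty = τ ∧ ω' = ω.setVar x v}
  | fieldAssign (e₁ : SemExpr) (f : FieldName) (e₂ : SemExpr) (ω : VState)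
      (a : Addr) (v : Val) (τ : VTyp) :
      e₁ ω = some (.ref (.addr a)) → e₂ ω = some v → ω.mask (a, f) = 1 →
      Γ.fields f = some τ → v.ty = τ →
      CRed Γ (.fieldAssign e₁ f e₂) ω {ω.setLoc (a, f) v}

/-- `C` is correct for `ω`: it executes successfully from `ω`. -/
def CStmt.Correct (Γ : Ctx) (C : CStmt) (ω : VState) : Prop :=
  ∃ S : Set VState, CRed Γ C ω S

/-! ## The translation of syntactic statements to ViperCore -/

/-- The semantic expression of a syntactic one, undefined where the expression is ill-defined.
A heap access is defined iff the heap has a value for the location. -/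
noncomputable def Expr.sem : Expr → SemExpr
  | .lit v, _ => some v
  | .var x, ω => ω.store x
  | .unop o e, ω =>
      match e.sem ω with
      | some v => (o.eval v).toOption
      | none => none
  | .binop e₁ o e₂, ω =>
      match e₁.sem ω with
      | some v₁ =>
        match o.evalLazy v₁ with
        | some v => some v
        | none =>
          match e₂.sem ω with
          | some v₂ => (o.eval v₁ v₂).toOption
          | none => none
      | none => none
  | .cond b e₁ e₂, ω =>
      match b.sem ω with
      | some (.bool true) => e₁.sem ω
      | some (.bool false) => e₂.sem ω
      | _ => none
  | .field e f, ω =>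
      match e.sem ω with
      | some (.ref (.addr a)) => ω.heap (a, f)
      | _ => none

/-- The set of states that satisfy an assertion. A state satisfying an assertion holds exactly the
permissions specified by it; knowledge of heap values is not restricted. -/
noncomputable def Assertion.sem : Assertion → Set VState
  | .pure e => {ω | e.sem ω = some (.bool true) ∧ ω.mask = 0}
  | .acc e f p =>
      {ω | ∃ (r : Ref) (q : ℝ), e.sem ω = some (.ref r) ∧ p.sem ω = some (.perm q) ∧
        match r with
        | .null => q = 0 ∧ ω.mask = 0
        | .addr a => ω.mask = Pi.single (a, f) q}
  | .accWild e f =>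
      {ω | ∃ (a : Addr) (q : ℝ), e.sem ω = some (.ref (.addr a)) ∧ 0 < q ∧
        ω.mask = Pi.single (a, f) q}
  | .star A B => sepConj A.sem B.sem
  | .imp e A =>
      {ω | (e.sem ω = some (.bool true) ∧ ω ∈ A.sem) ∨
        (e.sem ω = some (.bool false) ∧ ω.mask = 0)}
  | .cond e A B =>
      {ω | (e.sem ω = some (.bool true) ∧ ω ∈ A.sem) ∨
        (e.sem ω = some (.bool false) ∧ ω ∈ B.sem)}

/-- The translation `⟦s⟧`. -/
noncomputable def Stmt.compile : Stmt → CStmt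
  | .skip => .skip
  | .inhale A => .inhale A.sem
  | .exhale A => .exhale A.sem
  | .seq s₁ s₂ => .seq s₁.compile s₂.compile
  | .ite b s₁ s₂ => .ite b.sem s₁.compile s₂.compile
  | .assign x e => .assign x e.sem
  | .havoc x => .havoc x
  | .fieldAssign e₁ f e₂ => .fieldAssign e₁.sem f e₂.sem

/-! ## VCGSem: big-step semantics over total heaps -/

/-- VCGSem states: a store, a total heap and a permission mask. -/
structure TState where
  store : VarName → Option Val
  heap : Loc → Val
  mask : Loc → ℝ

/-- A total heap is well-typed. -/
def HeapTyped (Γ : Ctx) (h : Loc → Val) : Prop :=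
  ∀ (a : Addr) (f : FieldName) (τ : VTyp), Γ.fields f = some τ → (h (a, f)).ty = τ

namespace TState

def Typed (Γ : Ctx) (σ : TState) : Prop :=
  StoreTyped Γ σ.store ∧ HeapTyped Γ σ.heap

def setVar (σ : TState) (x : VarName) (v : Val) : TState :=
  { σ with store := Function.update σ.store x (some v) }

def setLoc (σ : TState) (l : Loc) (v : Val) : TState :=
  { σ with heap := Function.update σ.heap l v }

def setPerm (σ : TState) (l : Loc) (p : ℝ) : TState :=
  { σ with mask := Function.update σ.mask l p }

end TState

open Classical in
/-- Evaluation of an expression in the state `σ`. The permissions for heap accesses are checked in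
the well-definedness state `σ₀`; an access without permission or through `null` fails. -/
noncomputable def Expr.evalT (σ₀ σ : TState) : Expr → Res
  | .lit v => .val v
  | .var x =>
      match σ.store x with
      | some v => .val v
      | none => .stuck
  | .unop o e =>
      match e.evalT σ₀ σ with
      | .val v => o.eval v
      | .fail => .fail
      | .stuck => .stuck
  | .binop e₁ o e₂ =>
      match e₁.evalT σ₀ σ with
      | .val v₁ =>
        match o.evalLazy v₁ with
        | some v => .val v
        | none =>
          match e₂.evalT σ₀ σ with
          | .val v₂ => o.eval v₁ v₂
          | .fail => .fail
          | .stuck => .stuck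
      | .fail => .fail
      | .stuck => .stuck
  | .cond b e₁ e₂ =>
      match b.evalT σ₀ σ with
      | .val (.bool true) => e₁.evalT σ₀ σ
      | .val (.bool false) => e₂.evalT σ₀ σ
      | .fail => .fail
      | _ => .stuck
  | .field e f =>
      match e.evalT σ₀ σ with
      | .val (.ref (.addr a)) => if 0 < σ₀.mask (a, f) then .val (σ.heap (a, f)) else .fail
      | .val (.ref .null) => .fail
      | .fail => .fail
      | _ => .stuck

/-- Outcomes: failure, magic, or a normal outcome. -/
inductive Outcome
  | failure
  | magic
  | normal (σ : TState)

/-- Inhaling an assertion, from left to right. Expressions must be well-defined in the current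
state. The heap does not change. Inconsistent assumptions lead to magic. -/
inductive InhaleRed : Assertion → TState → Outcome → Prop
  | pureTrue {e : Expr} {σ : TState} :
      e.evalT σ σ = .val (.bool true) → InhaleRed (.pure e) σ (.normal σ)
  | pureFalse {e : Expr} {σ : TState} :
      e.evalT σ σ = .val (.bool false) → InhaleRed (.pure e) σ .magic
  | pureFail {e : Expr} {σ : TState} :
      e.evalT σ σ = .fail → InhaleRed (.pure e) σ .failure
  | acc {e p : Expr} {f : FieldName} {σ : TState} {a : Addr} {q : ℝ} :
      e.evalT σ σ = .val (.ref (.addr a)) → p.evalT σ σ = .val (.perm q) →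
      0 ≤ q → σ.mask (a, f) + q ≤ 1 →
      InhaleRed (.acc e f p) σ (.normal (σ.setPerm (a, f) (σ.mask (a, f) + q)))
  | accMagic {e p : Expr} {f : FieldName} {σ : TState} {a : Addr} {q : ℝ} :
      e.evalT σ σ = .val (.ref (.addr a)) → p.evalT σ σ = .val (.perm q) →
      0 ≤ q → 1 < σ.mask (a, f) + q →
      InhaleRed (.acc e f p) σ .magic
  | accNull {e p : Expr} {f : FieldName} {σ : TState} :
      e.evalT σ σ = .val (.ref .null) → p.evalT σ σ = .val (.perm 0) →
      InhaleRed (.acc e f p) σ (.normal σ)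
  | accNullMagic {e p : Expr} {f : FieldName} {σ : TState} {q : ℝ} :
      e.evalT σ σ = .val (.ref .null) → p.evalT σ σ = .val (.perm q) → 0 < q →
      InhaleRed (.acc e f p) σ .magic
  | accNeg {e p : Expr} {f : FieldName} {σ : TState} {r : Ref} {q : ℝ} :
      e.evalT σ σ = .val (.ref r) → p.evalT σ σ = .val (.perm q) → q < 0 →
      InhaleRed (.acc e f p) σ .failure
  | accFailRecv {e p : Expr} {f : FieldName} {σ : TState} :
      e.evalT σ σ = .fail → InhaleRed (.acc e f p) σ .failure
  | accFailPerm {e p : Expr} {f : FieldName} {σ : TState} {v : Val} :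
      e.evalT σ σ = .val v → p.evalT σ σ = .fail → InhaleRed (.acc e f p) σ .failure
  | wild {e : Expr} {f : FieldName} {σ : TState} {a : Addr} {q : ℝ} :
      e.evalT σ σ = .val (.ref (.addr a)) → 0 < q → σ.mask (a, f) + q ≤ 1 →
      InhaleRed (.accWild e f) σ (.normal (σ.setPerm (a, f) (σ.mask (a, f) + q)))
  | wildMagic {e : Expr} {f : FieldName} {σ : TState} {a : Addr} :
      e.evalT σ σ = .val (.ref (.addr a)) → 1 ≤ σ.mask (a, f) →
      InhaleRed (.accWild e f) σ .magic
  | wildNull {e : Expr} {f : FieldName} {σ : TState} :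
      e.evalT σ σ = .val (.ref .null) → InhaleRed (.accWild e f) σ .magic
  | wildFail {e : Expr} {f : FieldName} {σ : TState} :
      e.evalT σ σ = .fail → InhaleRed (.accWild e f) σ .failure
  | star {A B : Assertion} {σ σ' : TState} {r : Outcome} :
      InhaleRed A σ (.normal σ') → InhaleRed B σ' r → InhaleRed (.star A B) σ r
  | starFailure {A B : Assertion} {σ : TState} :
      InhaleRed A σ .failure → InhaleRed (.star A B) σ .failure
  | starMagic {A B : Assertion} {σ : TState} :
      InhaleRed A σ .magic → InhaleRed (.star A B) σ .magic
  | impTrue {e : Expr} {A : Assertion} {σ : TState} {r : Outcome} :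
      e.evalT σ σ = .val (.bool true) → InhaleRed A σ r → InhaleRed (.imp e A) σ r
  | impFalse {e : Expr} {A : Assertion} {σ : TState} :
      e.evalT σ σ = .val (.bool false) → InhaleRed (.imp e A) σ (.normal σ)
  | impFail {e : Expr} {A : Assertion} {σ : TState} :
      e.evalT σ σ = .fail → InhaleRed (.imp e A) σ .failure
  | condTrue {e : Expr} {A B : Assertion} {σ : TState} {r : Outcome} :
      e.evalT σ σ = .val (.bool true) → InhaleRed A σ r → InhaleRed (.cond e A B) σ r
  | condFalse {e : Expr} {A B : Assertion} {σ : TState} {r : Outcome} :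
      e.evalT σ σ = .val (.bool false) → InhaleRed B σ r → InhaleRed (.cond e A B) σ r
  | condFail {e : Expr} {A B : Assertion} {σ : TState} :
      e.evalT σ σ = .fail → InhaleRed (.cond e A B) σ .failure

/-- Removing the permissions of an assertion, from left to right, and checking its logical
constraints. Expressions must be well-defined in the state `σ₀` before the exhale. A wildcard
demonically removes a non-zero amount smaller than the amount currently held. -/
inductive ExhaleRed (σ₀ : TState) : Assertion → TState → Outcome → Prop
  | pureTrue {e : Expr} {σ : TState} :
      e.evalT σ₀ σ = .val (.bool true) → ExhaleRed σ₀ (.pure e) σ (.normal σ)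
  | pureFalse {e : Expr} {σ : TState} :
      e.evalT σ₀ σ = .val (.bool false) → ExhaleRed σ₀ (.pure e) σ .failure
  | pureFail {e : Expr} {σ : TState} :
      e.evalT σ₀ σ = .fail → ExhaleRed σ₀ (.pure e) σ .failure
  | acc {e p : Expr} {f : FieldName} {σ : TState} {a : Addr} {q : ℝ} :
      e.evalT σ₀ σ = .val (.ref (.addr a)) → p.evalT σ₀ σ = .val (.perm q) →
      0 ≤ q → q ≤ σ.mask (a, f) →
      ExhaleRed σ₀ (.acc e f p) σ (.normal (σ.setPerm (a, f) (σ.mask (a, f) - q)))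
  | accFailure {e p : Expr} {f : FieldName} {σ : TState} {a : Addr} {q : ℝ} :
      e.evalT σ₀ σ = .val (.ref (.addr a)) → p.evalT σ₀ σ = .val (.perm q) →
      (q < 0 ∨ σ.mask (a, f) < q) →
      ExhaleRed σ₀ (.acc e f p) σ .failure
  | accNull {e p : Expr} {f : FieldName} {σ : TState} :
      e.evalT σ₀ σ = .val (.ref .null) → p.evalT σ₀ σ = .val (.perm 0) →
      ExhaleRed σ₀ (.acc e f p) σ (.normal σ)
  | accNullFailure {e p : Expr} {f : FieldName} {σ : TState} {q : ℝ} :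
      e.evalT σ₀ σ = .val (.ref .null) → p.evalT σ₀ σ = .val (.perm q) → q ≠ 0 →
      ExhaleRed σ₀ (.acc e f p) σ .failure
  | accFailRecv {e p : Expr} {f : FieldName} {σ : TState} :
      e.evalT σ₀ σ = .fail → ExhaleRed σ₀ (.acc e f p) σ .failure
  | accFailPerm {e p : Expr} {f : FieldName} {σ : TState} {v : Val} :
      e.evalT σ₀ σ = .val v → p.evalT σ₀ σ = .fail → ExhaleRed σ₀ (.acc e f p) σ .failure
  | wild {e : Expr} {f : FieldName} {σ : TState} {a : Addr} {q : ℝ} :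
      e.evalT σ₀ σ = .val (.ref (.addr a)) → 0 < q → q < σ.mask (a, f) →
      ExhaleRed σ₀ (.accWild e f) σ (.normal (σ.setPerm (a, f) (σ.mask (a, f) - q)))
  | wildFailure {e : Expr} {f : FieldName} {σ : TState} {a : Addr} :
      e.evalT σ₀ σ = .val (.ref (.addr a)) → σ.mask (a, f) ≤ 0 →
      ExhaleRed σ₀ (.accWild e f) σ .failure
  | wildNull {e : Expr} {f : FieldName} {σ : TState} :
      e.evalT σ₀ σ = .val (.ref .null) → ExhaleRed σ₀ (.accWild e f) σ .failure
  | wildFail {e : Expr} {f : FieldName} {σ : TState} :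
      e.evalT σ₀ σ = .fail → ExhaleRed σ₀ (.accWild e f) σ .failure
  | star {A B : Assertion} {σ σ' : TState} {r : Outcome} :
      ExhaleRed σ₀ A σ (.normal σ') → ExhaleRed σ₀ B σ' r → ExhaleRed σ₀ (.star A B) σ r
  | starFailure {A B : Assertion} {σ : TState} :
      ExhaleRed σ₀ A σ .failure → ExhaleRed σ₀ (.star A B) σ .failure
  | impTrue {e : Expr} {A : Assertion} {σ : TState} {r : Outcome} :
      e.evalT σ₀ σ = .val (.bool true) → ExhaleRed σ₀ A σ r → ExhaleRed σ₀ (.imp e A) σ r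
  | impFalse {e : Expr} {A : Assertion} {σ : TState} :
      e.evalT σ₀ σ = .val (.bool false) → ExhaleRed σ₀ (.imp e A) σ (.normal σ)
  | impFail {e : Expr} {A : Assertion} {σ : TState} :
      e.evalT σ₀ σ = .fail → ExhaleRed σ₀ (.imp e A) σ .failure
  | condTrue {e : Expr} {A B : Assertion} {σ : TState} {r : Outcome} :
      e.evalT σ₀ σ = .val (.bool true) → ExhaleRed σ₀ A σ r → ExhaleRed σ₀ (.cond e A B) σ r
  | condFalse {e : Expr} {A B : Assertion} {σ : TState} {r : Outcome} :
      e.evalT σ₀ σ = .val (.bool false) → ExhaleRed σ₀ B σ r → ExhaleRed σ₀ (.cond e A B) σ r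
  | condFail {e : Expr} {A B : Assertion} {σ : TState} :
      e.evalT σ₀ σ = .fail → ExhaleRed σ₀ (.cond e A B) σ .failure

/-- The big-step semantics `Γ ⊢ ⟨s, σ⟩ → r` of VCGSem. -/
inductive TRed (Γ : Ctx) : Stmt → TState → Outcome → Prop
  | skip (σ : TState) : TRed Γ .skip σ (.normal σ)
  | inhale {A : Assertion} {σ : TState} {r : Outcome} :
      InhaleRed A σ r → TRed Γ (.inhale A) σ r
  /- After the permissions have been removed, all locations to which all permission was lost
  non-deterministically get new values (of the right types). -/
  | exhale {A : Assertion} {σ σ' : TState} {h : Loc → Val} :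
      ExhaleRed σ A σ (.normal σ') →
      (∀ l, ¬ (0 < σ.mask l ∧ σ'.mask l = 0) → h l = σ'.heap l) → HeapTyped Γ h →
      TRed Γ (.exhale A) σ (.normal { σ' with heap := h })
  | exhaleFailure {A : Assertion} {σ : TState} :
      ExhaleRed σ A σ .failure → TRed Γ (.exhale A) σ .failure
  | seq {s₁ s₂ : Stmt} {σ σ' : TState} {r : Outcome} :
      TRed Γ s₁ σ (.normal σ') → TRed Γ s₂ σ' r → TRed Γ (.seq s₁ s₂) σ r
  | seqFailure {s₁ s₂ : Stmt} {σ : TState} :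
      TRed Γ s₁ σ .failure → TRed Γ (.seq s₁ s₂) σ .failure
  | seqMagic {s₁ s₂ : Stmt} {σ : TState} :
      TRed Γ s₁ σ .magic → TRed Γ (.seq s₁ s₂) σ .magic
  | iteTrue {b : Expr} {s₁ s₂ : Stmt} {σ : TState} {r : Outcome} :
      b.evalT σ σ = .val (.bool true) → TRed Γ s₁ σ r → TRed Γ (.ite b s₁ s₂) σ r
  | iteFalse {b : Expr} {s₁ s₂ : Stmt} {σ : TState} {r : Outcome} :
      b.evalT σ σ = .val (.bool false) → TRed Γ s₂ σ r → TRed Γ (.ite b s₁ s₂) σ r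
  | iteFail {b : Expr} {s₁ s₂ : Stmt} {σ : TState} :
      b.evalT σ σ = .fail → TRed Γ (.ite b s₁ s₂) σ .failure
  | assign {x : VarName} {e : Expr} {σ : TState} {τ : VTyp} {v : Val} :
      Γ.vars x = some τ → e.evalT σ σ = .val v → v.ty = τ →
      TRed Γ (.assign x e) σ (.normal (σ.setVar x v))
  | assignFail {x : VarName} {e : Expr} {σ : TState} :
      e.evalT σ σ = .fail → TRed Γ (.assign x e) σ .failure
  | havoc {x : VarName} {σ : TState} {τ : VTyp} {v : Val} :
      Γ.vars x = some τ → v.ty = τ → TRed Γ (.havoc x) σ (.normal (σ.setVar x v))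
  | fieldAssign {e₁ e₂ : Expr} {f : FieldName} {σ : TState} {a : Addr} {v : Val} {τ : VTyp} :
      e₁.evalT σ σ = .val (.ref (.addr a)) → e₂.evalT σ σ = .val v → σ.mask (a, f) = 1 →
      Γ.fields f = some τ → v.ty = τ →
      TRed Γ (.fieldAssign e₁ f e₂) σ (.normal (σ.setLoc (a, f) v))
  | fieldAssignFailure {e₁ e₂ : Expr} {f : FieldName} {σ : TState} {a : Addr} {v : Val} :
      e₁.evalT σ σ = .val (.ref (.addr a)) → e₂.evalT σ σ = .val v → σ.mask (a, f) ≠ 1 →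
      TRed Γ (.fieldAssign e₁ f e₂) σ .failure
  | fieldAssignNull {e₁ e₂ : Expr} {f : FieldName} {σ : TState} {v : Val} :
      e₁.evalT σ σ = .val (.ref .null) → e₂.evalT σ σ = .val v →
      TRed Γ (.fieldAssign e₁ f e₂) σ .failure
  | fieldAssignFailRecv {e₁ e₂ : Expr} {f : FieldName} {σ : TState} :
      e₁.evalT σ σ = .fail → TRed Γ (.fieldAssign e₁ f e₂) σ .failure
  | fieldAssignFailVal {e₁ e₂ : Expr} {f : FieldName} {σ : TState} {v : Val} :
      e₁.evalT σ σ = .val v → e₂.evalT σ σ = .fail →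
      TRed Γ (.fieldAssign e₁ f e₂) σ .failure

/-! ## Relating the states -/

/-- The ViperCore state `ω` is related to the (well-typed) VCGSem state `σ`: the stores and the
permission masks are identical, and the total heap extends the partial one. The total heap is
arbitrary at the locations without a value in `ω`, so `ω` is related to many VCGSem states. -/
def VCGRel (Γ : Ctx) (ω : VState) (σ : TState) : Prop :=
  σ.Typed Γ ∧ σ.store = ω.store ∧ σ.mask = ω.mask ∧
    ∀ l v, ω.heap l = some v → σ.heap l = v

end ViperVCG

/-!
The proof is a backward simulation, by induction on the statement. A ViperCore state `ω` stands for
the set of all total states related to it. If no total state of this set fails on `s`, then `s` has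
a ViperCore execution whose final states `ω'` satisfy `Simulated`: *every* total state related to
`ω'` is reached by `s` from *some* total state related to `ω`. With this invariant, a failure of
the second part of a sequential composition, from a total state related to an intermediate
ViperCore state, is a failure of the whole composition from a total state related to `ω`, so the
induction goes through (`Stmt.Typed.sound`).

Since `ω` is stable, its partial heap is the part of the total heap that passes the permission
checks. Hence an expression that does not fail is defined in `ω` and has the same value in all
related total states (`Expr.Typed.exists_value`).

*Inhale.* Let `a` satisfy `A` and be compatible with `ω`, and choose a total heap that extends both
`ω` and `a`. As the total execution does not fail, it follows `a` and adds its permissions, and it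
reads only locations to which there is permission at the time of the access. So `A` still holds
when the other values are erased from `a` (`Assertion.inhale_of_sem`). This yields both the
simulation and one half of self-framing; the other half is the monotonicity of assertions in the
partial heap (`Assertion.sem_mono`).

*Exhale.* The total executions from the states related to `ω` can all remove the same permissions,
and these permissions, together with the whole heap of `ω`, satisfy `A`
(`Assertion.Typed.exhale`). The angelic choice of ViperCore is the remaining state, stabilized; the
values that it forgets are those that the total semantics havocs.
-/

namespace ViperVCG

/-! ### Expressions -/

theorem Expr.sem_mono {ω ω' : VState} (hs : ω.store = ω'.store)
    (hh : ∀ l v, ω.heap l = some v → ω'.heap l = some v) (e : Expr) {v : Val}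
    (h : e.sem ω = some v) : e.sem ω' = some v := by
  induction e generalizing v with
  | lit w => simpa [Expr.sem] using h
  | var x => simpa [Expr.sem, hs] using h
  | unop o e ih =>
    simp only [Expr.sem] at h ⊢
    split at h
    · next w hw => rw [ih hw]; exact h
    · simp at h
  | binop e₁ o e₂ ih₁ ih₂ =>
    simp only [Expr.sem] at h ⊢
    split at h
    · next v₁ hv₁ =>
      rw [ih₁ hv₁]
      dsimp only
      cases hl : o.evalLazy v₁ with
      | some u => rw [hl] at h; exact h
      | none =>
        rw [hl] at h
        dsimp only at h ⊢
        split at h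
        · next v₂ hv₂ => rw [ih₂ hv₂]; exact h
        · simp at h
    · simp at h
  | cond b e₁ e₂ ihb ih₁ ih₂ =>
    simp only [Expr.sem] at h ⊢
    split at h
    · next hb => rw [ihb hb]; exact ih₁ h
    · next hb => rw [ihb hb]; exact ih₂ h
    · simp at h
  | field e f ih =>
    simp only [Expr.sem] at h ⊢
    split at h
    · next a ha => rw [ih ha]; exact hh _ _ h
    · simp at h

theorem Res.toOption_eq_some {r : Res} {v : Val} : r.toOption = some v ↔ r = .val v := by
  cases r <;> simp [Res.toOption]

/-- If the total heap extends the partial one, the only way in which the total-heap evaluation can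
differ from a defined partial-heap evaluation is by a failing permission check, at a location that
has a value but no permission. -/
theorem Expr.evalT_of_sem {ω : VState} {σ₀ σ : TState} (hs : σ.store = ω.store)
    (hh : ∀ l v, ω.heap l = some v → σ.heap l = v) (e : Expr) {v : Val}
    (h : e.sem ω = some v) :
    e.evalT σ₀ σ = .val v ∨
      (e.evalT σ₀ σ = .fail ∧ ∃ l, (ω.heap l).isSome ∧ ¬ 0 < σ₀.mask l) := by
  induction e generalizing v with
  | lit w => left; simpa [Expr.sem, Expr.evalT] using h
  | var x =>
    left
    simp only [Expr.sem] at h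
    simp [Expr.evalT, hs, h]
  | unop o e ih =>
    simp only [Expr.sem] at h
    simp only [Expr.evalT]
    split at h
    · next w hw =>
      rw [Res.toOption_eq_some] at h
      rcases ih hw with h' | ⟨h', hl⟩
      · rw [h']; exact Or.inl h
      · rw [h']; exact Or.inr ⟨rfl, hl⟩
    · simp at h
  | binop e₁ o e₂ ih₁ ih₂ =>
    simp only [Expr.sem] at h
    simp only [Expr.evalT]
    split at h
    · next v₁ hv₁ =>
      rcases ih₁ hv₁ with h' | ⟨h', hl⟩
      · rw [h']
        dsimp only
        cases hz : o.evalLazy v₁ with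
        | some u =>
          rw [hz] at h
          dsimp only at h ⊢
          left; simpa using h
        | none =>
          rw [hz] at h
          dsimp only at h ⊢
          split at h
          · next v₂ hv₂ =>
            rw [Res.toOption_eq_some] at h
            rcases ih₂ hv₂ with h'' | ⟨h'', hl⟩
            · rw [h'']; exact Or.inl h
            · rw [h'']; exact Or.inr ⟨rfl, hl⟩
          · simp at h
      · rw [h']; exact Or.inr ⟨rfl, hl⟩
    · simp at h
  | cond b e₁ e₂ ihb ih₁ ih₂ =>
    simp only [Expr.sem] at h
    simp only [Expr.evalT]
    split at h
    · next hb =>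
      rcases ihb hb with h' | ⟨h', hl⟩
      · rw [h']; exact ih₁ h
      · rw [h']; exact Or.inr ⟨rfl, hl⟩
    · next hb =>
      rcases ihb hb with h' | ⟨h', hl⟩
      · rw [h']; exact ih₂ h
      · rw [h']; exact Or.inr ⟨rfl, hl⟩
    · simp at h
  | field e f ih =>
    simp only [Expr.sem] at h
    simp only [Expr.evalT]
    split at h
    · next a ha =>
      rcases ih ha with h' | ⟨h', hl⟩
      · rw [h']
        dsimp only
        split_ifs with hp
        · left; rw [hh _ _ h]
        · exact Or.inr ⟨rfl, (a, f), by simp [h], hp⟩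
      · rw [h']; exact Or.inr ⟨rfl, hl⟩
    · simp at h

/-- A total-heap evaluation reads only locations that pass the permission check, so it is
reproduced by every partial heap that contains these locations. -/
theorem Expr.sem_of_evalT {ω : VState} {σ₀ σ : TState} (hs : σ.store = ω.store)
    (hh : ∀ l, 0 < σ₀.mask l → ω.heap l = some (σ.heap l)) (e : Expr) {v : Val}
    (h : e.evalT σ₀ σ = .val v) : e.sem ω = some v := by
  induction e generalizing v with
  | lit w => simpa [Expr.sem, Expr.evalT] using h
  | var x =>
    simp only [Expr.evalT] at h
    split at h
    · next w hw => simp only [Expr.sem, ← hs, hw]; simpa using h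
    · simp at h
  | unop o e ih =>
    simp only [Expr.evalT] at h
    simp only [Expr.sem]
    split at h
    · next w hw => rw [ih hw]; exact Res.toOption_eq_some.2 h
    · simp at h
    · simp at h
  | binop e₁ o e₂ ih₁ ih₂ =>
    simp only [Expr.evalT] at h
    simp only [Expr.sem]
    split at h
    · next v₁ hv₁ =>
      rw [ih₁ hv₁]
      dsimp only
      cases hz : o.evalLazy v₁ with
      | some u =>
        rw [hz] at h
        dsimp only at h ⊢
        simpa using h
      | none =>
        rw [hz] at h
        dsimp only at h ⊢
        split at h
        · next v₂ hv₂ => rw [ih₂ hv₂]; exact Res.toOption_eq_some.2 h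
        · simp at h
        · simp at h
    · simp at h
    · simp at h
  | cond b e₁ e₂ ihb ih₁ ih₂ =>
    simp only [Expr.evalT] at h
    simp only [Expr.sem]
    split at h
    · next hb => rw [ihb hb]; exact ih₁ h
    · next hb => rw [ihb hb]; exact ih₂ h
    · simp at h
    · simp at h
  | field e f ih =>
    simp only [Expr.evalT] at h
    simp only [Expr.sem]
    split at h
    · next a ha =>
      rw [ih ha]
      dsimp only
      split_ifs at h with hp
      rw [hh _ hp]
      simpa using h
    · simp at h
    · simp at h
    · simp at h

theorem Unop.Sig.eval {o : Unop} {τ τ' : VTyp} (ho : Unop.Sig o τ τ') {v : Val}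
    (hv : v.ty = τ) : ∃ u, o.eval v = .val u ∧ u.ty = τ' := by
  cases ho <;> cases v <;> simp_all [Val.ty, Unop.eval]

theorem Binop.Sig.eval {o : Binop} {τ₁ τ₂ τ : VTyp} (ho : Binop.Sig o τ₁ τ₂ τ) {v w : Val}
    (hv : v.ty = τ₁) (hw : w.ty = τ₂) :
    o.eval v w = .fail ∨ ∃ u, o.eval v w = .val u ∧ u.ty = τ := by
  cases ho <;> cases v <;> cases hv <;> cases w <;> cases hw <;>
    simp only [Binop.eval] <;> (try split_ifs) <;> simp [Val.ty]

theorem Binop.Sig.evalLazy {o : Binop} {τ₁ τ₂ τ : VTyp} (ho : Binop.Sig o τ₁ τ₂ τ) {v u : Val}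
    (h : o.evalLazy v = some u) : u.ty = τ := by
  unfold Binop.evalLazy at h
  split at h <;> cases ho <;> cases h <;> rfl

/-- Well-typed expressions never get stuck. -/
theorem Expr.Typed.evalT {Γ : Ctx} {e : Expr} {τ : VTyp} (he : e.Typed Γ τ) {σ₀ σ : TState}
    (hσ : σ.Typed Γ) :
    e.evalT σ₀ σ = .fail ∨ ∃ v, e.evalT σ₀ σ = .val v ∧ v.ty = τ := by
  induction he with
  | lit v => right; exact ⟨v, by simp [Expr.evalT], rfl⟩
  | var hx =>
    obtain ⟨v, hv, ht⟩ := hσ.1 _ _ hx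
    right; exact ⟨v, by simp [Expr.evalT, hv], ht⟩
  | unop _ ho ih =>
    simp only [Expr.evalT]
    rcases ih with h | ⟨v, h, ht⟩
    · left; rw [h]
    · right; rw [h]; exact ho.eval ht
  | @binop e₁ e₂ o _ _ _ _ _ ho ih₁ ih₂ =>
    simp only [Expr.evalT]
    rcases ih₁ with h₁ | ⟨v₁, h₁, ht₁⟩
    · left; rw [h₁]
    · rw [h₁]
      dsimp only
      cases hz : o.evalLazy v₁ with
      | some u => right; exact ⟨u, rfl, ho.evalLazy hz⟩
      | none =>
        rcases ih₂ with h₂ | ⟨v₂, h₂, ht₂⟩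
        · left; rw [h₂]
        · rw [h₂]; exact ho.eval ht₁ ht₂
  | cond _ _ _ ihb ih₁ ih₂ =>
    simp only [Expr.evalT]
    rcases ihb with h | ⟨v, h, ht⟩
    · left; rw [h]
    · rw [h]
      cases v <;> cases ht
      next b => cases b <;> assumption
  | field _ hf ih =>
    simp only [Expr.evalT]
    rcases ih with h | ⟨v, h, ht⟩
    · left; rw [h]
    · rw [h]
      cases v <;> cases ht
      next r =>
      cases r with
      | null => left; rfl
      | addr a =>
        dsimp only
        split_ifs
        · right; exact ⟨_, rfl, hσ.2 _ _ _ hf⟩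
        · left; rfl

/-! ### States -/

theorem VState.eq_of_fields {a b : VState} (hs : a.store = b.store) (hh : a.heap = b.heap)
    (hm : a.mask = b.mask) : a = b := by
  cases a; cases b; cases hs; cases hh; cases hm; rfl

theorem VState.add_eq_some_iff {a b c : VState} :
    VState.add a b = some c ↔
      a.store = b.store ∧ (∀ l v w, a.heap l = some v → b.heap l = some w → v = w) ∧
        c.store = a.store ∧ (∀ l, c.heap l = (a.heap l).or (b.heap l)) ∧
        ∀ l, c.mask l = a.mask l + b.mask l := by
  unfold VState.add
  constructor
  · intro h
    split_ifs at h with hc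
    cases h
    exact ⟨hc.1, hc.2.2, rfl, fun _ => rfl, fun _ => rfl⟩
  · rintro ⟨hs, hh, cs, ch, cm⟩
    have hc : VState.Compat a b := ⟨hs, fun l => cm l ▸ c.mask_le_one l, hh⟩
    rw [dif_pos hc]
    exact congrArg some (VState.eq_of_fields cs.symm (funext fun l => (ch l).symm)
      (funext fun l => (cm l).symm))

theorem VState.heap_left_of_add {a b c : VState} (h : VState.add a b = some c) {l : Loc} {v : Val}
    (hl : a.heap l = some v) : c.heap l = some v := by
  rw [(VState.add_eq_some_iff.1 h).2.2.2.1, hl]; rfl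

theorem VState.heap_right_of_add {a b c : VState} (h : VState.add a b = some c) {l : Loc} {v : Val}
    (hl : b.heap l = some v) : c.heap l = some v := by
  obtain ⟨-, hh, -, ch, -⟩ := VState.add_eq_some_iff.1 h
  rw [ch]
  cases ha : a.heap l with
  | none => simpa using hl
  | some w => rw [hh l w v ha hl]; rfl

/-- Addition when the second heap already is the union of the heaps. -/
theorem VState.add_of_heap_eq {a b c : VState} (as : a.store = c.store) (bs : b.store = c.store)
    (ah : ∀ l v, a.heap l = some v → c.heap l = some v) (bh : b.heap = c.heap)
    (hm : ∀ l, c.mask l = a.mask l + b.mask l) : VState.add a b = some c := by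
  refine VState.add_eq_some_iff.2 ⟨as.trans bs.symm, ?_, as.symm, ?_, hm⟩
  · intro l v w hv hw
    have := ah l v hv
    rw [bh, this] at hw
    simpa using hw
  · intro l
    cases ha : a.heap l with
    | none => simp [bh]
    | some v => simp [ah l v ha]

theorem VState.stabilize_heap_of_pos {ω : VState} {l : Loc} (h : 0 < ω.mask l) :
    ω.stabilize.heap l = ω.heap l := if_pos h

theorem VState.heap_of_stabilize_heap {ω : VState} {l : Loc} {v : Val}
    (h : ω.stabilize.heap l = some v) : ω.heap l = some v := by
  unfold VState.stabilize at h
  dsimp only at h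
  split_ifs at h
  exact h

theorem VState.stable_stabilize (ω : VState) : ω.stabilize.Stable := by
  refine fun l => ⟨fun h => ?_, ω.stabilize.heap_isSome l⟩
  unfold VState.stabilize at h
  dsimp only at h
  split_ifs at h with hp
  · exact hp
  · simp at h

/-- The state `ω` with some of its permissions removed, but all of its heap values. -/
def VState.withMask (ω : VState) (m : Loc → ℝ) (h₀ : ∀ l, 0 ≤ m l) (h₁ : ∀ l, m l ≤ ω.mask l) :
    VState where
  store := ω.store
  heap := ω.heap
  mask := m
  mask_nonneg := h₀
  mask_le_one l := (h₁ l).trans (ω.mask_le_one l)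
  heap_isSome l hl := ω.heap_isSome l (hl.trans_le (h₁ l))

/-- To satisfy a separating conjunction it suffices to split the permissions: both parts may keep
all heap values. -/
theorem VState.mem_sepConj {P Q : Set VState} {ω : VState} {m₁ m₂ : Loc → ℝ}
    (h₁ : ∀ l, 0 ≤ m₁ l) (h₂ : ∀ l, 0 ≤ m₂ l) (hm : ∀ l, ω.mask l = m₁ l + m₂ l)
    (hP : ∀ a : VState, a.store = ω.store → a.heap = ω.heap → a.mask = m₁ → a ∈ P)
    (hQ : ∀ b : VState, b.store = ω.store → b.heap = ω.heap → b.mask = m₂ → b ∈ Q) :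
    ω ∈ sepConj P Q :=
  ⟨ω.withMask m₁ h₁ fun l => by linarith [hm l, h₂ l], hP _ rfl rfl rfl,
    ω.withMask m₂ h₂ fun l => by linarith [hm l, h₁ l], hQ _ rfl rfl rfl,
    VState.add_of_heap_eq rfl rfl (fun _ _ h => h) rfl hm⟩

/-- Assertions constrain permissions exactly, but are preserved by adding heap values. -/
theorem Assertion.sem_mono (A : Assertion) {ω ω' : VState} (hs : ω.store = ω'.store)
    (hm : ω.mask = ω'.mask) (hh : ∀ l v, ω.heap l = some v → ω'.heap l = some v)
    (h : ω ∈ A.sem) : ω' ∈ A.sem := by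
  induction A generalizing ω ω' with
  | pure e => exact ⟨e.sem_mono hs hh h.1, hm ▸ h.2⟩
  | acc e f p =>
    obtain ⟨r, q, h₁, h₂, h₃⟩ := h
    exact ⟨r, q, e.sem_mono hs hh h₁, p.sem_mono hs hh h₂, hm ▸ h₃⟩
  | accWild e f =>
    obtain ⟨a, q, h₁, h₂, h₃⟩ := h
    exact ⟨a, q, e.sem_mono hs hh h₁, h₂, hm ▸ h₃⟩
  | star A B ihA ihB =>
    obtain ⟨a, ha, b, hb, hab⟩ := h
    obtain ⟨s₁, -, s₂, -, cm⟩ := VState.add_eq_some_iff.1 hab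
    refine VState.mem_sepConj a.mask_nonneg b.mask_nonneg (hm ▸ cm) ?_ ?_
    · intro a' as ah am
      exact ihA (by rw [as, ← hs, s₂]) am.symm
        (fun l v hv => ah ▸ hh l v (VState.heap_left_of_add hab hv)) ha
    · intro b' bs bh bm
      exact ihB (by rw [bs, ← hs, s₂, s₁]) bm.symm
        (fun l v hv => bh ▸ hh l v (VState.heap_right_of_add hab hv)) hb
  | imp e A ih =>
    rcases h with ⟨h₁, h₂⟩ | ⟨h₁, h₂⟩
    · exact Or.inl ⟨e.sem_mono hs hh h₁, ih hs hm hh h₂⟩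
    · exact Or.inr ⟨e.sem_mono hs hh h₁, hm ▸ h₂⟩
  | cond e A B ihA ihB =>
    rcases h with ⟨h₁, h₂⟩ | ⟨h₁, h₂⟩
    · exact Or.inl ⟨e.sem_mono hs hh h₁, ihA hs hm hh h₂⟩
    · exact Or.inr ⟨e.sem_mono hs hh h₁, ihB hs hm hh h₂⟩

/-- An arbitrary value of each type. -/
def VTyp.default : VTyp → Val
  | .int => .int 0
  | .bool => .bool false
  | .perm => .perm 0
  | .ref => .ref .null

theorem VTyp.ty_default (τ : VTyp) : τ.default.ty = τ := by cases τ <;> rfl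

/-- Every well-typed partial heap extends to a well-typed total heap. -/
theorem VState.exists_heapTyped {Γ : Ctx} {ω : VState} (h : ω.Typed Γ) :
    ∃ H : Loc → Val, HeapTyped Γ H ∧ ∀ l v, ω.heap l = some v → H l = v := by
  refine ⟨fun l => (ω.heap l).getD (((Γ.fields l.2).map VTyp.default).getD (.int 0)), ?_, ?_⟩
  · intro a f τ hf
    cases hv : ω.heap (a, f) with
    | none => simp [hf, hv, VTyp.ty_default]
    | some v => simpa [hv] using h.2 a f v τ hv hf
  · intro l v hv
    simp [hv]

theorem VCGRel.exists {Γ : Ctx} {ω : VState} (h : ω.Typed Γ) : ∃ σ, VCGRel Γ ω σ := by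
  obtain ⟨H, hH, hext⟩ := VState.exists_heapTyped h
  exact ⟨⟨ω.store, H, ω.mask⟩, ⟨h.1, hH⟩, rfl, rfl, hext⟩

theorem VCGRel.heap_eq {Γ : Ctx} {ω : VState} {σ : TState} (h : VCGRel Γ ω σ) {l : Loc}
    (hl : 0 < ω.mask l) : ω.heap l = some (σ.heap l) := by
  obtain ⟨v, hv⟩ := Option.isSome_iff_exists.1 (ω.heap_isSome l hl)
  rw [hv, h.2.2.2 l v hv]

/-- A well-typed expression that does not fail for one total state related to `ω` has a value in
`ω`, and it has the same value in all related total states. Permissions are checked with the mask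
of `ω`; the current mask `m` may be smaller, as it is in the middle of an exhale. -/
theorem Expr.Typed.exists_value {Γ : Ctx} {e : Expr} {τ : VTyp} (he : e.Typed Γ τ) {ω : VState}
    (hst : ω.Stable) {σ : TState} (hσ : VCGRel Γ ω σ) (m : Loc → ℝ)
    (hf : e.evalT σ { σ with mask := m } ≠ .fail) :
    ∃ v, v.ty = τ ∧ e.sem ω = some v ∧
      ∀ (σ' : TState), VCGRel Γ ω σ' → ∀ m', e.evalT σ' { σ' with mask := m' } = .val v := by
  rcases he.evalT (σ₀ := σ) (σ := { σ with mask := m }) hσ.1 with h | ⟨v, h, ht⟩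
  · exact absurd h hf
  have hsem : e.sem ω = some v :=
    Expr.sem_of_evalT (σ₀ := σ) (σ := { σ with mask := m }) hσ.2.1
      (fun l hl => hσ.heap_eq (hσ.2.2.1 ▸ hl)) e h
  refine ⟨v, ht, hsem, fun σ' hσ' m' => ?_⟩
  rcases Expr.evalT_of_sem (σ₀ := σ') (σ := { σ' with mask := m' }) hσ'.2.1 hσ'.2.2.2 e hsem with
    h' | ⟨-, l, hl, hn⟩
  · exact h'
  · rw [hσ'.2.2.1] at hn
    exact absurd ((hst l).1 hl) hn

/-! ### Inhale -/

/-- During an inhale, an expression that is defined in the inhaled state `a` and does not fail has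
the same value in `σ` and in every partial heap that agrees with that of `σ` at the locations with
permission after the inhale. -/
theorem Expr.inhale_of_sem (e : Expr) {a : VState} {σ : TState} {v : Val} (h : e.sem a = some v)
    (hs : σ.store = a.store) (hh : ∀ l v, a.heap l = some v → σ.heap l = v)
    (hne : e.evalT σ σ ≠ .fail) :
    e.evalT σ σ = .val v ∧ ∀ a' : VState, a'.store = a.store →
      (∀ l, 0 < σ.mask l + a.mask l → a'.heap l = some (σ.heap l)) → e.sem a' = some v := by
  have h' : e.evalT σ σ = .val v := (e.evalT_of_sem hs hh h).resolve_right fun h => hne h.1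
  refine ⟨h', fun a' ha' hext => e.sem_of_evalT (hs.trans ha'.symm) (fun l hl => hext l ?_) h'⟩
  linarith [a.mask_nonneg l]

theorem TState.add_single (σ : TState) (l : Loc) (q : ℝ) :
    ({ σ with mask := σ.mask + Pi.single l q } : TState) = σ.setPerm l (σ.mask l + q) := by
  unfold TState.setPerm
  congr 1
  funext l'
  by_cases hl : l' = l
  · subst hl; simp
  · simp [hl]

/-- If inhaling `A` from `σ` cannot fail and `a` satisfies `A` with values taken from the heap of
`σ`, then one execution adds exactly the permissions of `a`; moreover, the values that `A` needs
are those of locations with permission after the inhale, so that `A` already holds for any partial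
heap that contains these. -/
theorem Assertion.inhale_of_sem (A : Assertion) {a : VState} {σ : TState} (ha : a ∈ A.sem)
    (hs : σ.store = a.store) (hh : ∀ l v, a.heap l = some v → σ.heap l = v)
    (h₀ : ∀ l, 0 ≤ σ.mask l) (h₁ : ∀ l, σ.mask l + a.mask l ≤ 1)
    (hf : ¬ InhaleRed A σ .failure) :
    InhaleRed A σ (.normal { σ with mask := σ.mask + a.mask }) ∧
      ∀ a' : VState, a'.store = a.store → a'.mask = a.mask →
        (∀ l, 0 < σ.mask l + a.mask l → a'.heap l = some (σ.heap l)) → a' ∈ A.sem := by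
  induction A generalizing a σ with
  | pure e =>
    obtain ⟨hv, hm⟩ := ha
    obtain ⟨h, hsem⟩ := e.inhale_of_sem hv hs hh fun h => hf (.pureFail h)
    refine ⟨?_, fun a' hs' hm' hext => ⟨hsem a' hs' hext, hm'.trans hm⟩⟩
    rw [hm, add_zero]
    exact .pureTrue h
  | acc e f p =>
    obtain ⟨r, q, hr, hq, hm⟩ := ha
    obtain ⟨h, hsem⟩ := e.inhale_of_sem hr hs hh fun h => hf (.accFailRecv h)
    obtain ⟨h', hsem'⟩ := p.inhale_of_sem hq hs hh fun h' => hf (.accFailPerm h h')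
    refine ⟨?_, fun a' hs' hm' hext =>
      ⟨r, q, hsem a' hs' hext, hsem' a' hs' hext, hm'.symm ▸ hm⟩⟩
    cases r with
    | null =>
      obtain ⟨rfl, hm⟩ := hm
      rw [hm, add_zero]
      exact .accNull h h'
    | addr x =>
      have hq : a.mask (x, f) = q := by rw [hm]; simp
      rw [hm, TState.add_single]
      exact .acc h h' (hq ▸ a.mask_nonneg _) (hq ▸ h₁ _)
  | accWild e f =>
    obtain ⟨x, q, hx, hpos, hm⟩ := ha
    obtain ⟨h, hsem⟩ := e.inhale_of_sem hx hs hh fun h => hf (.wildFail h)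
    have hq : a.mask (x, f) = q := by rw [hm]; simp
    rw [hm, TState.add_single]
    refine ⟨.wild h hpos (hq ▸ h₁ _), fun a' hs' hm' hext => ⟨x, q, hsem a' hs' ?_, hpos, hm'⟩⟩
    rwa [hm]
  | star A B ihA ihB =>
    obtain ⟨b, hb, c, hc, hbc⟩ := ha
    obtain ⟨s₁, -, s₂, -, cm⟩ := VState.add_eq_some_iff.1 hbc
    have hmask : a.mask = b.mask + c.mask := funext cm
    obtain ⟨redA, hA⟩ := ihA hb (hs.trans s₂)
      (fun l v hv => hh l v (VState.heap_left_of_add hbc hv)) h₀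
      (fun l => by linarith [h₁ l, cm l, c.mask_nonneg l]) fun h => hf (.starFailure h)
    obtain ⟨redB, hB⟩ := ihB (σ := { σ with mask := σ.mask + b.mask }) hc
      (hs.trans (s₂.trans s₁)) (fun l v hv => hh l v (VState.heap_right_of_add hbc hv))
      (fun l => add_nonneg (h₀ l) (b.mask_nonneg l))
      (fun l => by simp only [Pi.add_apply]; linarith [h₁ l, cm l]) fun h => hf (.star redA h)
    refine ⟨?_, fun a' hs' hm' hext => ?_⟩
    · rw [hmask, ← add_assoc]
      exact .star redA redB
    · refine VState.mem_sepConj b.mask_nonneg c.mask_nonneg (hm' ▸ cm) ?_ ?_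
      · intro b' bs bh bm
        refine hA b' (by rw [bs, hs', s₂]) bm fun l hl => bh ▸ hext l ?_
        linarith [cm l, c.mask_nonneg l]
      · intro c' cs ch cm'
        refine hB c' (by rw [cs, hs', s₂, s₁]) cm' fun l hl => ch ▸ hext l ?_
        simp only [Pi.add_apply] at hl
        linarith [cm l]
  | imp e A ih =>
    have hne : e.evalT σ σ ≠ .fail := fun h => hf (.impFail h)
    rcases ha with ⟨hv, hA⟩ | ⟨hv, hm⟩
    · obtain ⟨h, hsem⟩ := e.inhale_of_sem hv hs hh hne
      obtain ⟨hred, hA'⟩ := ih hA hs hh h₀ h₁ (fun hf' => hf (.impTrue h hf'))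
      exact ⟨.impTrue h hred, fun a' hs' hm' hext =>
        Or.inl ⟨hsem a' hs' hext, hA' a' hs' hm' hext⟩⟩
    · obtain ⟨h, hsem⟩ := e.inhale_of_sem hv hs hh hne
      refine ⟨?_, fun a' hs' hm' hext => Or.inr ⟨hsem a' hs' hext, hm'.trans hm⟩⟩
      rw [hm, add_zero]
      exact .impFalse h
  | cond e A B ihA ihB =>
    have hne : e.evalT σ σ ≠ .fail := fun h => hf (.condFail h)
    rcases ha with ⟨hv, hA⟩ | ⟨hv, hB⟩
    · obtain ⟨h, hsem⟩ := e.inhale_of_sem hv hs hh hne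
      obtain ⟨hred, hA'⟩ := ihA hA hs hh h₀ h₁ (fun hf' => hf (.condTrue h hf'))
      exact ⟨.condTrue h hred, fun a' hs' hm' hext =>
        Or.inl ⟨hsem a' hs' hext, hA' a' hs' hm' hext⟩⟩
    · obtain ⟨h, hsem⟩ := e.inhale_of_sem hv hs hh hne
      obtain ⟨hred, hB'⟩ := ihB hB hs hh h₀ h₁ (fun hf' => hf (.condFalse h hf'))
      exact ⟨.condFalse h hred, fun a' hs' hm' hext =>
        Or.inr ⟨hsem a' hs' hext, hB' a' hs' hm' hext⟩⟩

/-- If inhaling `A` cannot fail for any state related to `ω`, then `ω` frames `A`. -/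
theorem Assertion.frames_of_inhale {Γ : Ctx} {A : Assertion} {ω : VState} (hst : ω.Stable)
    (hf : ∀ σ, VCGRel Γ ω σ → ¬ InhaleRed A σ .failure) : Frames Γ ω A.sem := by
  intro ω' hω'
  constructor
  · rintro ⟨ω₁, hω₁, a, ha, hadd⟩
    obtain rfl : ω = ω₁ := hω₁.symm
    obtain ⟨s₁, -, s₂, -, cm⟩ := VState.add_eq_some_iff.1 hadd
    -- The total heap is chosen to extend the values of `a`, even at locations without permission.
    obtain ⟨H, hH, hext⟩ := VState.exists_heapTyped hω'
    have hrel : VCGRel Γ ω ⟨ω.store, H, ω.mask⟩ :=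
      ⟨⟨s₂ ▸ hω'.1, hH⟩, rfl, rfl, fun l v hv => hext l v (VState.heap_left_of_add hadd hv)⟩
    obtain ⟨-, hsem⟩ := A.inhale_of_sem ha s₁
      (fun l v hv => hext l v (VState.heap_right_of_add hadd hv)) ω.mask_nonneg
      (fun l => cm l ▸ ω'.mask_le_one l) (hf _ hrel)
    let a' : VState :=
      { a with
        heap := ω'.stabilize.heap
        heap_isSome := fun l hl => ω'.stabilize.heap_isSome l
          (show 0 < ω'.mask l by linarith [cm l, ω.mask_nonneg l]) }
    refine ⟨ω, rfl, a', hsem a' rfl rfl fun l hl => ?_,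
      VState.add_of_heap_eq s₂.symm (s₁.symm.trans s₂.symm) (fun l v hv => ?_) rfl cm⟩
    · have hl' : 0 < ω'.mask l := by rw [cm]; exact hl
      obtain ⟨v, hv⟩ := Option.isSome_iff_exists.1 (ω'.heap_isSome l hl')
      change ω'.stabilize.heap l = some (H l)
      rw [VState.stabilize_heap_of_pos hl', hv, hext l v hv]
    · have hl' : 0 < ω'.mask l := by
        have := (hst l).1 (by simp [hv])
        linarith [cm l, a.mask_nonneg l]
      change ω'.stabilize.heap l = some v
      rw [VState.stabilize_heap_of_pos hl', VState.heap_left_of_add hadd hv]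
  · rintro ⟨ω₁, hω₁, a, ha, hadd⟩
    obtain rfl : ω = ω₁ := hω₁.symm
    obtain ⟨s₁, -, s₂, -, cm⟩ := VState.add_eq_some_iff.1 hadd
    have hle : ∀ l v, ω'.stabilize.heap l = some v → ω'.heap l = some v :=
      fun _ _ => VState.heap_of_stabilize_heap
    let a' : VState :=
      { a with
        heap := ω'.heap
        heap_isSome := fun l hl => ω'.heap_isSome l
          (show 0 < ω'.stabilize.mask l by linarith [cm l, ω.mask_nonneg l]) }
    exact ⟨ω, rfl, a',
      A.sem_mono (ω := a) rfl rfl (fun l v hv => hle l v (VState.heap_right_of_add hadd hv)) ha,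
      VState.add_of_heap_eq s₂.symm (s₁.symm.trans s₂.symm)
        (fun l v hv => hle l v (VState.heap_left_of_add hadd hv)) rfl cm⟩

/-! ### Exhale -/

theorem sub_update_sub (m : Loc → ℝ) (l : Loc) (q : ℝ) :
    m - Function.update m l (m l - q) = Pi.single l q := by
  funext l'
  by_cases hl : l' = l
  · subst hl; simp
  · simp [hl]

theorem update_sub_mem {m : Loc → ℝ} (h₀ : ∀ l, 0 ≤ m l) {l : Loc} {q : ℝ} (hq : 0 ≤ q)
    (hqm : q ≤ m l) :
    (∀ l', 0 ≤ Function.update m l (m l - q) l') ∧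
      ∀ l', Function.update m l (m l - q) l' ≤ m l' := by
  refine ⟨fun l' => ?_, fun l' => ?_⟩ <;> by_cases hl : l' = l
  · subst hl; simpa using hqm
  · simpa [hl] using h₀ l'
  · subst hl; simpa using hq
  · simp [hl]

/-- If exhaling `A` with current mask `m` cannot fail from one state related to `ω`, then all
states related to `ω` can end with one and the same mask `m'`, and `ω` with the removed permissions
`m - m'` satisfies `A`. For wildcards, half of the held amount is removed. -/
theorem Assertion.Typed.exhale {Γ : Ctx} {A : Assertion} (hA : A.Typed Γ) {ω : VState}
    (hst : ω.Stable) {σ : TState} (hσ : VCGRel Γ ω σ) {m : Loc → ℝ} (h₀ : ∀ l, 0 ≤ m l)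
    (h₁ : ∀ l, m l ≤ ω.mask l) (hf : ¬ ExhaleRed σ A { σ with mask := m } .failure) :
    ∃ m' : Loc → ℝ, ((∀ l, 0 ≤ m' l) ∧ ∀ l, m' l ≤ m l) ∧
      (∀ σ', VCGRel Γ ω σ' →
        ExhaleRed σ' A { σ' with mask := m } (.normal { σ' with mask := m' })) ∧
      ∀ a : VState, a.store = ω.store → a.heap = ω.heap → a.mask = m - m' → a ∈ A.sem := by
  have hsem : ∀ {a : VState}, a.store = ω.store → a.heap = ω.heap → ∀ {e : Expr} {v : Val},
      e.sem ω = some v → e.sem a = some v := fun as ah e _ h =>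
    e.sem_mono as.symm (fun l v hv => ah ▸ hv) h
  induction A generalizing m with
  | pure e =>
    obtain ⟨v, ht, hv, hev⟩ := hA.exists_value hst hσ m fun h => hf (.pureFail h)
    cases v <;> cases ht
    next b =>
    cases b with
    | false => exact absurd (.pureFalse (hev σ hσ m)) hf
    | true =>
      exact ⟨m, ⟨h₀, fun _ => le_rfl⟩, fun σ' hσ' => .pureTrue (hev σ' hσ' m),
        fun a as ah am => ⟨hsem as ah hv, by rw [am, sub_self]⟩⟩
  | acc e f p =>
    obtain ⟨he, -, hp⟩ := hA
    obtain ⟨v, ht, hv, hev⟩ := he.exists_value hst hσ m fun h => hf (.accFailRecv h)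
    obtain ⟨w, ht', hw, hew⟩ := hp.exists_value hst hσ m fun h => hf (.accFailPerm (hev σ hσ m) h)
    cases w <;> cases ht'
    next q =>
    cases v <;> cases ht
    next r =>
    cases r with
    | null =>
      obtain rfl : q = 0 := by
        by_contra hq
        exact hf (.accNullFailure (hev σ hσ m) (hew σ hσ m) hq)
      exact ⟨m, ⟨h₀, fun _ => le_rfl⟩, fun σ' hσ' => .accNull (hev σ' hσ' m) (hew σ' hσ' m),
        fun a as ah am => ⟨.null, 0, hsem as ah hv, hsem as ah hw, rfl, by rw [am, sub_self]⟩⟩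
    | addr x =>
      have hq : 0 ≤ q ∧ q ≤ m (x, f) := by
        by_contra hq
        refine hf (.accFailure (hev σ hσ m) (hew σ hσ m) ?_)
        by_contra hn
        push Not at hn
        exact hq hn
      exact ⟨_, update_sub_mem h₀ hq.1 hq.2,
        fun σ' hσ' => .acc (σ := { σ' with mask := m }) (hev σ' hσ' m) (hew σ' hσ' m) hq.1 hq.2,
        fun a as ah am => ⟨.addr x, q, hsem as ah hv, hsem as ah hw,
          am.trans (sub_update_sub m _ q)⟩⟩
  | accWild e f =>
    obtain ⟨v, ht, hv, hev⟩ := hA.1.exists_value hst hσ m fun h => hf (.wildFail h)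
    cases v <;> cases ht
    next r =>
    cases r with
    | null => exact absurd (.wildNull (hev σ hσ m)) hf
    | addr x =>
      have hpos : 0 < m (x, f) := by
        by_contra hn
        exact hf (.wildFailure (hev σ hσ m) (not_lt.1 hn))
      exact ⟨_, update_sub_mem h₀ (half_pos hpos).le (half_lt_self hpos).le,
        fun σ' hσ' => .wild (σ := { σ' with mask := m }) (hev σ' hσ' m) (half_pos hpos)
          (half_lt_self hpos),
        fun a as ah am => ⟨x, _, hsem as ah hv, half_pos hpos, am.trans (sub_update_sub m _ _)⟩⟩
  | star A B ihA ihB =>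
    obtain ⟨m₁, ⟨hp₁, hle₁⟩, red₁, sem₁⟩ := ihA hA.1 h₀ h₁ fun h => hf (.starFailure h)
    obtain ⟨m₂, ⟨hp₂, hle₂⟩, red₂, sem₂⟩ := ihB hA.2 hp₁ (fun l => (hle₁ l).trans (h₁ l))
      fun h => hf (.star (red₁ σ hσ) h)
    refine ⟨m₂, ⟨hp₂, fun l => (hle₂ l).trans (hle₁ l)⟩,
      fun σ' hσ' => .star (red₁ σ' hσ') (red₂ σ' hσ'), fun a as ah am => ?_⟩
    refine VState.mem_sepConj (m₁ := m - m₁) (m₂ := m₁ - m₂) (fun l => sub_nonneg.2 (hle₁ l))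
      (fun l => sub_nonneg.2 (hle₂ l)) (fun l => by rw [am]; simp)
      (fun b bs bh bm => sem₁ b (bs.trans as) (bh.trans ah) bm)
      fun b bs bh bm => sem₂ b (bs.trans as) (bh.trans ah) bm
  | imp e A ih =>
    obtain ⟨v, ht, hv, hev⟩ := hA.1.exists_value hst hσ m fun h => hf (.impFail h)
    cases v <;> cases ht
    next b =>
    cases b with
    | false =>
      exact ⟨m, ⟨h₀, fun _ => le_rfl⟩, fun σ' hσ' => .impFalse (hev σ' hσ' m),
        fun a as ah am => Or.inr ⟨hsem as ah hv, by rw [am, sub_self]⟩⟩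
    | true =>
      obtain ⟨m', hm', red, sem⟩ := ih hA.2 h₀ h₁ fun h => hf (.impTrue (hev σ hσ m) h)
      exact ⟨m', hm', fun σ' hσ' => .impTrue (hev σ' hσ' m) (red σ' hσ'),
        fun a as ah am => Or.inl ⟨hsem as ah hv, sem a as ah am⟩⟩
  | cond e A B ihA ihB =>
    obtain ⟨v, ht, hv, hev⟩ := hA.1.exists_value hst hσ m fun h => hf (.condFail h)
    cases v <;> cases ht
    next b =>
    cases b with
    | false =>
      obtain ⟨m', hm', red, sem⟩ := ihB hA.2.2 h₀ h₁ fun h => hf (.condFalse (hev σ hσ m) h)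
      exact ⟨m', hm', fun σ' hσ' => .condFalse (hev σ' hσ' m) (red σ' hσ'),
        fun a as ah am => Or.inr ⟨hsem as ah hv, sem a as ah am⟩⟩
    | true =>
      obtain ⟨m', hm', red, sem⟩ := ihA hA.2.1 h₀ h₁ fun h => hf (.condTrue (hev σ hσ m) h)
      exact ⟨m', hm', fun σ' hσ' => .condTrue (hev σ' hσ' m) (red σ' hσ'),
        fun a as ah am => Or.inl ⟨hsem as ah hv, sem a as ah am⟩⟩

/-! ### Statements -/

theorem StoreTyped.update {Γ : Ctx} {s : VarName → Option Val} (hs : StoreTyped Γ s) {x : VarName}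
    {v : Val} (hx : Γ.vars x = some v.ty) : StoreTyped Γ (Function.update s x (some v)) := by
  intro y τ hy
  by_cases h : y = x
  · subst h
    rw [hx] at hy
    exact ⟨v, by simp, Option.some.inj hy⟩
  · simpa [h] using hs y τ hy

/-- Variable updates are simulated: a total state related to `ω[x ↦ v]` is the update of a total
state related to `ω`. -/
theorem VCGRel.of_setVar {Γ : Ctx} {ω : VState} (hω : ω.Typed Γ) {x : VarName} {v : Val}
    {σ' : TState} (h : VCGRel Γ (ω.setVar x v) σ') :
    ∃ σ, VCGRel Γ ω σ ∧ σ.setVar x v = σ' := by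
  refine ⟨{ σ' with store := ω.store }, ⟨⟨hω.1, h.1.2⟩, rfl, h.2.2⟩, ?_⟩
  obtain ⟨s, H, m⟩ := σ'
  obtain ⟨-, hs, -, -⟩ := h
  cases hs
  rfl

/-- The postcondition of the simulation: each final state of ViperCore is stable and well-typed,
and all total states related to it are reached by `s` from total states related to `ω`. This
reachability lets the absence of failures be passed on to the second part of a sequential
composition. -/
def Simulated (Γ : Ctx) (s : Stmt) (ω ω' : VState) : Prop :=
  ω'.Stable ∧ ω'.Typed Γ ∧
    ∀ σ', VCGRel Γ ω' σ' → ∃ σ, VCGRel Γ ω σ ∧ TRed Γ s σ (.normal σ')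

theorem Stmt.sound_inhale {Γ : Ctx} {A : Assertion} {ω : VState} (hst : ω.Stable)
    (hf : ∀ σ, VCGRel Γ ω σ → ¬ TRed Γ (.inhale A) σ .failure) :
    ∃ S, CRed Γ (Stmt.inhale A).compile ω S ∧ ∀ ω' ∈ S, Simulated Γ (.inhale A) ω ω' := by
  have hf' : ∀ σ, VCGRel Γ ω σ → ¬ InhaleRed A σ .failure := fun σ hσ h => hf σ hσ (.inhale h)
  refine ⟨_, .inhale _ _ (Assertion.frames_of_inhale hst hf'), ?_⟩
  rintro ω' ⟨⟨a, ha, hadd⟩, hst', hty'⟩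
  refine ⟨hst', hty', fun σ' hσ' => ?_⟩
  obtain ⟨s₁, -, s₂, -, cm⟩ := VState.add_eq_some_iff.1 hadd
  have hrel : VCGRel Γ ω { σ' with mask := ω.mask } :=
    ⟨hσ'.1, hσ'.2.1.trans s₂, rfl,
      fun l v hv => hσ'.2.2.2 l v (VState.heap_left_of_add hadd hv)⟩
  have hred := (A.inhale_of_sem ha (hrel.2.1.trans s₁)
    (fun l v hv => hσ'.2.2.2 l v (VState.heap_right_of_add hadd hv)) ω.mask_nonneg
    (fun l => cm l ▸ ω'.mask_le_one l) (hf' _ hrel)).1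
  have hm : ω.mask + a.mask = σ'.mask := by
    rw [hσ'.2.2.1]; exact (funext cm).symm
  refine ⟨_, hrel, ?_⟩
  simp only [hm] at hred
  exact .inhale hred

theorem Stmt.Typed.sound_exhale {Γ : Ctx} {A : Assertion} (hA : A.Typed Γ) {ω : VState}
    (hst : ω.Stable) (hty : ω.Typed Γ)
    (hf : ∀ σ, VCGRel Γ ω σ → ¬ TRed Γ (.exhale A) σ .failure) :
    ∃ S, CRed Γ (Stmt.exhale A).compile ω S ∧ ∀ ω' ∈ S, Simulated Γ (.exhale A) ω ω' := by
  obtain ⟨σ₀, hσ₀⟩ := VCGRel.exists hty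
  have hself : ({ σ₀ with mask := ω.mask } : TState) = σ₀ := by rw [← hσ₀.2.2.1]
  obtain ⟨m, ⟨h₀, h₁⟩, hred, hsem⟩ := hA.exhale hst hσ₀ ω.mask_nonneg (fun _ => le_rfl)
    (fun h => hf σ₀ hσ₀ (.exhaleFailure (hself ▸ h)))
  let ω' : VState := (ω.withMask m h₀ h₁).stabilize
  have hle : ∀ l v, ω'.heap l = some v → ω.heap l = some v :=
    fun _ _ => VState.heap_of_stabilize_heap (ω := ω.withMask m h₀ h₁)
  have hst' : ω'.Stable := VState.stable_stabilize _
  refine ⟨_, .exhale _ ω ω'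
    (ω.withMask (ω.mask - m) (fun l => sub_nonneg.2 (h₁ l)) fun l => sub_le_self _ (h₀ l))
    (VState.add_of_heap_eq rfl rfl hle rfl fun l => (add_sub_cancel (m l) (ω.mask l)).symm)
    (hsem _ rfl rfl rfl) hst', ?_⟩
  rintro _ rfl
  refine ⟨hst', ⟨hty.1, fun x f v τ hv => hty.2 x f v τ (hle _ _ hv)⟩, fun σ' hσ' => ?_⟩
  -- Before the exhale, the heap has the values of `ω`; where `ω` holds no permission, it already
  -- has the values of the final state, since these locations are not havocked.
  let σ : TState := ⟨ω.store, fun l => (ω.heap l).getD (σ'.heap l), ω.mask⟩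
  have hrel : VCGRel Γ ω σ := by
    refine ⟨⟨hty.1, fun x f τ hτ => ?_⟩, rfl, rfl, fun l v hv => by simp [σ, hv]⟩
    cases hv : ω.heap (x, f) with
    | none => simpa [σ, hv] using hσ'.1.2 x f τ hτ
    | some v => simpa [σ, hv] using hty.2 x f v τ hv hτ
  refine ⟨σ, hrel, ?_⟩
  have hh : ∀ l, ¬ (0 < σ.mask l ∧ m l = 0) → σ'.heap l = σ.heap l := by
    intro l hl
    by_cases hp : 0 < ω.mask l
    · have hm : 0 < m l := lt_of_le_of_ne (h₀ l) fun h => hl ⟨hp, h.symm⟩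
      simp [σ, hle l _ (hσ'.heap_eq (l := l) hm)]
    · have hn : ω.heap l = none := by
        by_contra hn
        exact hp ((hst l).1 (Option.isSome_iff_ne_none.2 hn))
      simp [σ, hn]
  have hfin : ({ σ with heap := σ'.heap, mask := m } : TState) = σ' := by
    obtain ⟨s, H, m'⟩ := σ'
    obtain ⟨-, hs, hm, -⟩ := hσ'
    cases hs; cases hm
    rfl
  have := TRed.exhale (h := σ'.heap) (hred σ hrel) hh hσ'.1.2
  rwa [hfin] at this

theorem Stmt.Typed.sound_fieldAssign {Γ : Ctx} {e₁ e₂ : Expr} {f : FieldName}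
    (hs : (Stmt.fieldAssign e₁ f e₂).Typed Γ) {ω : VState} (hst : ω.Stable) (hty : ω.Typed Γ)
    (hf : ∀ σ, VCGRel Γ ω σ → ¬ TRed Γ (.fieldAssign e₁ f e₂) σ .failure) :
    ∃ S, CRed Γ (Stmt.fieldAssign e₁ f e₂).compile ω S ∧
      ∀ ω' ∈ S, Simulated Γ (.fieldAssign e₁ f e₂) ω ω' := by
  obtain ⟨σ₀, hσ₀⟩ := VCGRel.exists hty
  obtain ⟨he₁, τ, hτ, he₂⟩ := hs
  obtain ⟨v₁, ht₁, hv₁, hev₁⟩ := he₁.exists_value hst hσ₀ σ₀.mask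
    fun h => hf σ₀ hσ₀ (.fieldAssignFailRecv h)
  obtain ⟨v, rfl, hv, hev⟩ := he₂.exists_value hst hσ₀ σ₀.mask
    fun h => hf σ₀ hσ₀ (.fieldAssignFailVal (hev₁ σ₀ hσ₀ _) h)
  cases v₁ <;> cases ht₁
  next r =>
  cases r with
  | null => exact absurd (.fieldAssignNull (hev₁ σ₀ hσ₀ _) (hev σ₀ hσ₀ _)) (hf σ₀ hσ₀)
  | addr x =>
    have hm : ω.mask (x, f) = 1 := by
      by_contra hm
      exact hf σ₀ hσ₀ (.fieldAssignFailure (hev₁ σ₀ hσ₀ _) (hev σ₀ hσ₀ _) (hσ₀.2.2.1 ▸ hm))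
    have hpos : 0 < ω.mask (x, f) := by rw [hm]; exact one_pos
    obtain ⟨w, hw⟩ := Option.isSome_iff_exists.1 (ω.heap_isSome _ hpos)
    refine ⟨_, .fieldAssign _ _ _ _ x v _ hv₁ hv hm hτ rfl, ?_⟩
    rintro _ rfl
    refine ⟨fun l => ?_, ⟨hty.1, fun y g u τ' hu hg => ?_⟩, fun σ' hσ' => ?_⟩
    · by_cases h : l = (x, f)
      · subst h; simpa [VState.setLoc] using hpos
      · simpa [VState.setLoc, h] using hst l
    · by_cases h : (y, g) = (x, f)
      · cases h
        rw [hτ] at hg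
        cases hg
        simp only [VState.setLoc, Function.update_self, Option.some.injEq] at hu
        rw [← hu]
      · simp only [VState.setLoc, Function.update_of_ne h] at hu
        exact hty.2 y g u τ' hu hg
    -- Writing the old value `w` back into a final state gives the related initial state.
    · have hext : ∀ l u, ω.heap l = some u → (σ'.setLoc (x, f) w).heap l = u := by
        intro l u hu
        by_cases h : l = (x, f)
        · subst h
          rw [hw] at hu
          simpa [TState.setLoc] using hu
        · simp only [TState.setLoc, Function.update_of_ne h]
          exact hσ'.2.2.2 l u (by simpa [VState.setLoc, h] using hu)
      have hrel : VCGRel Γ ω (σ'.setLoc (x, f) w) := by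
        refine ⟨⟨hσ'.1.1, fun y g τ' hg => ?_⟩, hσ'.2.1, hσ'.2.2.1, hext⟩
        by_cases h : (y, g) = (x, f)
        · rw [h, hext _ w hw]
          cases h
          exact hty.2 _ _ _ _ hw hg
        · simp only [TState.setLoc, Function.update_of_ne h]
          exact hσ'.1.2 y g τ' hg
      have hval : σ'.heap (x, f) = v := hσ'.2.2.2 _ v (by simp [VState.setLoc])
      have hfin : (σ'.setLoc (x, f) w).setLoc (x, f) v = σ' := by
        rw [← hval]
        simp [TState.setLoc]
      refine ⟨_, hrel, ?_⟩
      have := TRed.fieldAssign (hev₁ _ hrel _) (hev _ hrel _) (hrel.2.2.1 ▸ hm) hτ rfl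
      rwa [hfin] at this

/-- The soundness theorem, strengthened by the simulation of the final states. -/
theorem Stmt.Typed.sound {Γ : Ctx} {s : Stmt} (hs : s.Typed Γ) {ω : VState} (hst : ω.Stable)
    (hty : ω.Typed Γ) (hf : ∀ σ, VCGRel Γ ω σ → ¬ TRed Γ s σ .failure) :
    ∃ S, CRed Γ s.compile ω S ∧ ∀ ω' ∈ S, Simulated Γ s ω ω' := by
  -- One related total state suffices to see that the expressions are defined.
  obtain ⟨σ₀, hσ₀⟩ := VCGRel.exists hty
  induction s generalizing ω σ₀ with
  | skip =>
    refine ⟨_, .skip ω, ?_⟩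
    rintro _ rfl
    exact ⟨hst, hty, fun σ' hσ' => ⟨σ', hσ', .skip σ'⟩⟩
  | inhale A => exact Stmt.sound_inhale hst hf
  | exhale A => exact Stmt.Typed.sound_exhale hs hst hty hf
  | seq s₁ s₂ ih₁ ih₂ =>
    obtain ⟨S₁, hred₁, hS₁⟩ := ih₁ hs.1 hst hty (fun σ hσ h => hf σ hσ (.seqFailure h)) σ₀ hσ₀
    have key : ∀ ω₁ ∈ S₁, ∃ S, CRed Γ s₂.compile ω₁ S ∧ ∀ ω' ∈ S, Simulated Γ s₂ ω₁ ω' := by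
      intro ω₁ hω₁
      obtain ⟨hst₁, hty₁, hsim⟩ := hS₁ ω₁ hω₁
      obtain ⟨σ₁, hσ₁⟩ := VCGRel.exists hty₁
      refine ih₂ hs.2 hst₁ hty₁ (fun σ' hσ' h => ?_) σ₁ hσ₁
      obtain ⟨σ, hσ, hred⟩ := hsim σ' hσ'
      exact hf σ hσ (.seq hred h)
    choose! S hred₂ hS₂ using key
    refine ⟨_, .seq _ _ ω S₁ S hred₁ hred₂, fun ω' hω' => ?_⟩
    simp only [Set.mem_iUnion] at hω'
    obtain ⟨ω₁, hω₁, hω'⟩ := hω'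
    obtain ⟨hst', hty', hsim⟩ := hS₂ ω₁ hω₁ ω' hω'
    refine ⟨hst', hty', fun σ'' hσ'' => ?_⟩
    obtain ⟨σ', hσ', h₂⟩ := hsim σ'' hσ''
    obtain ⟨σ, hσ, h₁⟩ := (hS₁ ω₁ hω₁).2.2 σ' hσ'
    exact ⟨σ, hσ, .seq h₁ h₂⟩
  | ite b s₁ s₂ ih₁ ih₂ =>
    obtain ⟨v, ht, hv, hev⟩ := hs.1.exists_value hst hσ₀ σ₀.mask fun h => hf σ₀ hσ₀ (.iteFail h)
    cases v <;> cases ht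
    next c =>
    cases c with
    | true =>
      obtain ⟨S, hred, hS⟩ := ih₁ hs.2.1 hst hty
        (fun σ hσ h => hf σ hσ (.iteTrue (hev σ hσ _) h)) σ₀ hσ₀
      refine ⟨S, .iteTrue _ _ _ ω S hv hred, fun ω' hω' => ?_⟩
      obtain ⟨hst', hty', hsim⟩ := hS ω' hω'
      refine ⟨hst', hty', fun σ' hσ' => ?_⟩
      obtain ⟨σ, hσ, h⟩ := hsim σ' hσ'
      exact ⟨σ, hσ, .iteTrue (hev σ hσ _) h⟩
    | false =>
      obtain ⟨S, hred, hS⟩ := ih₂ hs.2.2 hst hty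
        (fun σ hσ h => hf σ hσ (.iteFalse (hev σ hσ _) h)) σ₀ hσ₀
      refine ⟨S, .iteFalse _ _ _ ω S hv hred, fun ω' hω' => ?_⟩
      obtain ⟨hst', hty', hsim⟩ := hS ω' hω'
      refine ⟨hst', hty', fun σ' hσ' => ?_⟩
      obtain ⟨σ, hσ, h⟩ := hsim σ' hσ'
      exact ⟨σ, hσ, .iteFalse (hev σ hσ _) h⟩
  | assign x e =>
    obtain ⟨τ, hx, he⟩ := hs
    obtain ⟨v, rfl, hv, hev⟩ := he.exists_value hst hσ₀ σ₀.mask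
      fun h => hf σ₀ hσ₀ (.assignFail h)
    refine ⟨_, .assign x _ ω _ v hx hv rfl, ?_⟩
    rintro _ rfl
    refine ⟨hst, ⟨hty.1.update hx, hty.2⟩, fun σ' hσ' => ?_⟩
    obtain ⟨σ, hσ, rfl⟩ := hσ'.of_setVar hty
    exact ⟨σ, hσ, .assign hx (hev σ hσ _) rfl⟩
  | havoc x =>
    obtain ⟨τ, hx⟩ := hs
    refine ⟨_, .havoc x ω τ hx, ?_⟩
    rintro _ ⟨v, rfl, rfl⟩
    refine ⟨hst, ⟨hty.1.update hx, hty.2⟩, fun σ' hσ' => ?_⟩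
    obtain ⟨σ, hσ, rfl⟩ := hσ'.of_setVar hty
    exact ⟨σ, hσ, .havoc hx rfl⟩
  | fieldAssign e₁ f e₂ => exact Stmt.Typed.sound_fieldAssign hs hst hty hf

end ViperVCG

theorem mainTheorem4 (Γ : ViperVCG.Ctx) (s : ViperVCG.Stmt) (hs : s.Typed Γ)
    (ω : ViperVCG.VState) (hstable : ω.Stable) (htyped : ω.Typed Γ)
    (hnofail : ∀ σ : ViperVCG.TState, ViperVCG.VCGRel Γ ω σ →
      ¬ ViperVCG.TRed Γ s σ ViperVCG.Outcome.failure) :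
    ViperVCG.CStmt.Correct Γ s.compile ω := by
  obtain ⟨S, hS, -⟩ := hs.sound hstable htyped hnofail
  exact ⟨S, hS⟩
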